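/- **Setting.** Let $K,n,m\ge 1$. Consider a fully connected network with $K$ layers, all of whose layers (including the input) have $n$ nodes. The parameter space is $W=W_1\times\dots\times W_K$ with $W_k=\mathbb R^{n\times n}$. For $w=(w_1,\dots,w_K)\in W$ and an input $y\in\mathbb R^n$ put $x^0(w;y)=y$ and $x^k_i(w;y)=\sigma\big(\sum_j w_{k,i,j}\,x^{k-1}_j(w;y)\big)$ for $1\le k\le K$. Here $\sigma:\mathbb R\to\mathbb R$ is twice differentiable with $\|\sigma\|_\infty\le 1$, $\|\sigma'\|_\infty<\infty$ and $\|\sigma''\|_\infty<\infty$. Given training pairs $(y_i,z_i)\in\mathbb R^n\times\mathbb R^n$, $1\le i\le m$, with $\|y_i\|_\infty\le 1$ and $\|z_i\|_\infty\le1$, let $$f(w)=\frac1m\sum_{i=1}^m\|x^K(w;y_i)-z_i\|_2^2 .$$ **Matrix norms.** Fix $q\in\{2,\infty\}$. Let $\|A\|_q$ be the matrix norm induced by the vector norm $\|\cdot\|_q$ (the largest singular value for $q=2$, the largest absolute row sum for $q=\infty$). For a linear functional $\ell$ on $\mathbb R^{n\times n}$, identified with a matrix through $\ell(A)=\sum_{i,j}\ell_{i,j}A_{i,j}$,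 let $\|\ell\|_q$ denote the dual norm: $\sum_i\sigma_i(\ell)$ (sum of the singular values) for $q=2$, and $\sum_i\max_j|\ell_{i,j}|$ for $q=\infty$. Let $\rho_q$ be the following duality map. For $q=2$, $\rho_2(\ell)=\|\ell\|_2\sum_{i\le\operatorname{rank}\ell}u_iv_i^T$, where $\ell=U\Sigma V^T$ is a singular value decomposition with singular vectors $u_i,v_i$. For $q=\infty$, $\rho_\infty(\ell)=\|\ell\|_\infty M$, where $M_{i,j}=\operatorname{sgn}(\ell_{i,j})$ if $j=\operatorname{argmax}_k|\ell_{i,k}|$ and $M_{i,j}=0$ otherwise. **Layer factors.** Let $c_q=\sqrt n,\ d_{q,1}=4\sqrt n,\ d_{q,2}=2$ if $q=2$, and $c_q=1,\ d_{q,1}=4n,\ d_{q,2}=2n$ if $q=\infty$. Put $r_k(\zeta_1,\dots,\zeta_k)=\|\sigma'\|_\infty^k\prod_{i\le k}\zeta_i$, $v_0=0$, $$v_k(\zeta_1,\dots,\zeta_k)=\|\sigma''\|_\infty\zeta_k^2\|\sigma'\|_\infty^{2(k-1)}\prod_{i<k}\zeta_i^2+\|\sigma'\|_\infty\zeta_k\,v_{k-1}(\zeta_1,\dots,\zeta_{k-1})\qquad(k\ge1),$$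 $$s_k=d_{q,2}c_q^2\|\sigma'\|_\infty^2r_k^2+d_{q,1}c_q^2\|\sigma'\|_\infty^2v_k+d_{q,1}c_q^2\|\sigma''\|_\infty r_k,$$ and $p_i(w)=\sqrt{s_{K-i}(\|w_{i+1}\|_q,\dots,\|w_K\|_q)+1}$ for $1\le i\le K$. **Finsler and duality structure.** For $w,u\in W$ let $\|u\|_w=\sum_{i=1}^Kp_i(w)\|u_i\|_q$, with dual norm $\|\ell\|_w=\sup_{\|u\|_w=1}\ell(u)$ for linear functionals $\ell=(\ell_1,\dots,\ell_K)$ on $W$. Let $\rho_w(\ell)\in W$ have $i^*$-th component $p_{i^*}(w)^{-2}\rho_q(\ell_{i^*})$ and all other components $0$, where $i^*=\operatorname{argmax}_i\,p_i(w)^{-1}\|\ell_i\|_q$. In each argmax, ties are broken by an arbitrary fixed rule. **Algorithm (batch mode, constant step size $\varepsilon$).** Given $w(1)\in W$, for $t=1,2,\dots$ let $g(t)=\frac{\partial f}{\partial w}(w(t))$ and $i^*=\operatorname{argmax}_i\,p_i(w(t))^{-1}\|g_i(t)\|_q$. Set $w(t+1)_{i^*}=w(t)_{i^*}-\varepsilon\,p_{i^*}(w(t))^{-2}\rho_q(g_{i^*}(t))$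 and $w(t+1)_i=w(t)_i$ for $i\ne i^*$. **Proposition.** Let $\varepsilon\in(0,2)$ and let $w(1),w(2),\dots$ be generated by this algorithm. Then: 1. $f$ is continuously differentiable. Each $\|\cdot\|_w$ is a norm and $(w,u)\mapsto\|u\|_w$ is continuous (a Finsler structure). The map $\rho$ is a duality structure for it, that is, $\|\rho_w(\ell)\|_w=\|\ell\|_w$ and $\ell(\rho_w(\ell))=\|\ell\|_w^2$ for all $w,\ell$. The sequence is an instance of duality structure gradient descent: $w(t+1)=w(t)-\varepsilon\,\rho_{w(t)}\big(\frac{\partial f}{\partial w}(w(t))\big)$ for all $t\ge1$. 2. One of the following holds: (i) there is $T\ge1$ such that $f(w(t))<f(w(t-1))$ for $1<t\le T$ and $\frac{\partial f}{\partial w}(w(T))=0$; or (ii) $f(w(t))<f(w(t-1))$ for all $t>1$, $\lim_{t\to\infty}\|\frac{\partial f}{\partial w}(w(t))\|_{w(t)}=0$, and every accumulation point $w^*$ of the sequence satisfies $\frac{\partial f}{\partial w}(w^*)=0$. 3. For every $\delta>0$ and every integer $T\ge1$ with $T\ge\frac1{\delta^2}\frac{2}{\varepsilon(2-\varepsilon)}f(w(1))$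 one has $\min_{1\le t\le T}\|\frac{\partial f}{\partial w}(w(t))\|_{w(t)}\le\delta$. -/

import Mathlib

namespace NetDSGD

open Matrix

noncomputable section

/-! ### Finsler structures, duality structures and duality structure gradient descent -/

section Abstract

variable {E : Type*} [NormedAddCommGroup E] [NormedSpace ℝ E]

/-- `N w u` is the size of `u` at the point `w`: every `N w` is a norm and
`(w, u) ↦ N w u` is jointly continuous. -/
structure IsFinslerStructure (N : E → E → ℝ) : Prop where
  nonneg : ∀ w u, 0 ≤ N w u
  eq_zero_iff : ∀ w u, N w u = 0 ↔ u = 0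
  smul : ∀ w (c : ℝ) u, N w (c • u) = |c| * N w u
  add_le : ∀ w u v, N w (u + v) ≤ N w u + N w v
  continuous : Continuous fun x : E × E => N x.1 x.2

/-- The dual norm at `w`: the supremum of `ℓ u` over all `u` with `N w u = 1`. -/
def dualNorm (N : E → E → ℝ) (w : E) (l : E →L[ℝ] ℝ) : ℝ :=
  sSup {a : ℝ | ∃ u : E, N w u = 1 ∧ a = l u}

/-- `ρ w` is a duality map for the norm `N w`, for every `w`. -/
def IsDualityStructure (N : E → E → ℝ) (ρ : E → (E →L[ℝ] ℝ) → E) : Prop :=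
  ∀ w l, N w (ρ w l) = dualNorm N w l ∧ l (ρ w l) = dualNorm N w l ^ 2

/-- The sequence `w(1), w(2), …` is generated by duality structure gradient descent with
step sizes `ε(1), ε(2), …` (the value `w 0` is not used). -/
def IsDSGD (f : E → ℝ) (ρ : E → (E →L[ℝ] ℝ) → E) (ε : ℕ → ℝ) (w : ℕ → E) : Prop :=
  ∀ t, 1 ≤ t → w (t + 1) = w t - ε t • ρ (w t) (fderiv ℝ f (w t))

/-- First alternative: strict decrease up to a time `T` at which the derivative vanishes. -/
def FiniteTermination (f : E → ℝ) (w : ℕ → E) : Prop :=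
  ∃ T, 1 ≤ T ∧ (∀ t, 1 < t → t ≤ T → f (w t) < f (w (t - 1))) ∧ fderiv ℝ f (w T) = 0

/-- Second alternative: strict decrease forever, the local dual norms of the derivatives tend to
zero, and every accumulation point of the sequence is stationary. -/
def AsymptoticConvergence (N : E → E → ℝ) (f : E → ℝ) (w : ℕ → E) : Prop :=
  (∀ t, 1 < t → f (w t) < f (w (t - 1))) ∧
  Filter.Tendsto (fun t => dualNorm N (w t) (fderiv ℝ f (w t))) Filter.atTop (nhds 0) ∧
  ∀ v : E, MapClusterPt v Filter.atTop w → fderiv ℝ f v = 0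

end Abstract

/-! ### The matrix norms -/

/-- The two admissible choices `q = 2` and `q = ∞`. -/
inductive QNorm
  | two
  | infty

/-- The singular values `σ_i(A)` in decreasing order, indexed from `0`. -/
def singVal {n : ℕ} (A : Matrix (Fin n) (Fin n) ℝ) (i : Fin n) : ℝ :=
  (Matrix.toEuclideanLin A).singularValues i

/-- `A = U Σ Vᵀ` with orthogonal `U`, `V` and the singular values in decreasing order. -/
structure IsSVD {n : ℕ} (A U V : Matrix (Fin n) (Fin n) ℝ) : Prop where
  left : U ∈ Matrix.orthogonalGroup (Fin n) ℝ
  right : V ∈ Matrix.orthogonalGroup (Fin n) ℝ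
  eq : A = U * Matrix.diagonal (singVal A) * Vᵀ

theorem exists_isSVD {n : ℕ} (A : Matrix (Fin n) (Fin n) ℝ) : ∃ U V, IsSVD A U V := by
  have hn : Module.finrank ℝ (EuclideanSpace ℝ (Fin n)) = n := by simp
  set T := Matrix.toEuclideanLin A with hT
  let v := T.isSymmetric_adjoint_comp_self.eigenvectorBasis hn
  have hTT : ∀ i j, inner ℝ (T (v i)) (T (v j)) = singVal A j ^ 2 * inner ℝ (v i) (v j) := by
    intro i j
    have h := T.isSymmetric_adjoint_comp_self.apply_eigenvectorBasis hn j
    rw [← LinearMap.adjoint_inner_right]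
    change inner ℝ (v i) ((LinearMap.adjoint T ∘ₗ T) (v j)) = _
    rw [show (LinearMap.adjoint T ∘ₗ T) (v j) = _ from h, inner_smul_right]
    rw [singVal, T.sq_singularValues_fin hn]
    rfl
  have horth : Pairwise fun i j => inner ℝ (T (v i)) (T (v j)) = 0 := by
    intro i j hij
    rw [hTT, v.inner_eq_zero hij, mul_zero]
  have hnorm : ∀ i, ‖T (v i)‖ = singVal A i := by
    intro i
    have h := hTT i i
    rw [real_inner_self_eq_norm_sq, real_inner_self_eq_norm_sq, v.norm_eq_one] at h
    have h0 : 0 ≤ singVal A i := T.singularValues_nonneg i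
    exact (sq_eq_sq₀ (norm_nonneg _) h0).1 (by simpa using h)
  let u := InnerProductSpace.gramSchmidtOrthonormalBasis (𝕜 := ℝ) (by simp) (fun i => T (v i))
  have hu : ∀ i, T (v i) = singVal A i • u i := by
    intro i
    by_cases h : T (v i) = 0
    · have : singVal A i = 0 := by rw [← hnorm i, h, norm_zero]
      rw [h, this, zero_smul]
    · have h1 : u i = (‖T (v i)‖⁻¹ : ℝ) • T (v i) :=
        InnerProductSpace.gramSchmidtOrthonormalBasis_apply_of_orthogonal (𝕜 := ℝ) (by simp)
          horth h
      rw [h1, smul_smul, ← hnorm i, mul_inv_cancel₀ (norm_ne_zero_iff.2 h), one_smul]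
  let mat : OrthonormalBasis (Fin n) ℝ (EuclideanSpace ℝ (Fin n)) → Matrix (Fin n) (Fin n) ℝ :=
    fun b => Matrix.of fun j i => b i j
  have hmat : ∀ b, mat b ∈ Matrix.orthogonalGroup (Fin n) ℝ := by
    intro b
    rw [Matrix.mem_orthogonalGroup_iff']
    ext i j
    have h := orthonormal_iff_ite.1 b.orthonormal j i
    rw [PiLp.inner_apply] at h
    simp only [Matrix.mul_apply, Matrix.one_apply, mat, Matrix.of_apply]
    simpa [eq_comm] using h
  refine ⟨mat u, mat v, hmat u, hmat v, ?_⟩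
  have hAV : A * mat v = mat u * Matrix.diagonal (singVal A) := by
    ext a i
    have h := congrArg (fun x : EuclideanSpace ℝ (Fin n) => x a) (hu i)
    simp only [hT, Matrix.toLpLin_apply, PiLp.smul_apply, smul_eq_mul] at h
    rw [Matrix.mul_diagonal]
    simp only [Matrix.mul_apply, mat, Matrix.of_apply]
    rw [mul_comm]
    simpa [Matrix.mulVec, dotProduct] using h
  have hVV : mat v * (mat v)ᵀ = 1 := (Matrix.mem_orthogonalGroup_iff (Fin n) ℝ).1 (hmat v)
  rw [← hAV, Matrix.mul_assoc, hVV, Matrix.mul_one]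

/-- Left singular vectors, as the columns of a matrix. -/
def svdLeft {n : ℕ} (A : Matrix (Fin n) (Fin n) ℝ) : Matrix (Fin n) (Fin n) ℝ :=
  (exists_isSVD A).choose

/-- Right singular vectors, as the columns of a matrix. -/
def svdRight {n : ℕ} (A : Matrix (Fin n) (Fin n) ℝ) : Matrix (Fin n) (Fin n) ℝ :=
  (exists_isSVD A).choose_spec.choose

/-- The matrix norm induced by the vector norm `‖·‖_q`: the spectral norm for `q = 2`, the largest
absolute row sum for `q = ∞`. -/
def matNorm {n : ℕ} : QNorm → Matrix (Fin n) (Fin n) ℝ → ℝ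
  | .two, A => ‖Matrix.toEuclideanCLM (n := Fin n) (𝕜 := ℝ) A‖
  | .infty, A => ⨆ i, ∑ j, |A i j|

/-- The dual norm of `matNorm`, under the pairing `∑ i j, l i j * A i j`: the sum of the singular
values for `q = 2`, the sum over the rows of the largest absolute entry for `q = ∞`. -/
def matDualNorm {n : ℕ} : QNorm → Matrix (Fin n) (Fin n) ℝ → ℝ
  | .two, l => ∑ i, singVal l i
  | .infty, l => ∑ i, ⨆ j, |l i j|

/-- A rule that returns the index of a largest entry of a vector; ties are broken arbitrarily. -/
def IsArgmaxRule {k : ℕ} (a : (Fin k → ℝ) → Fin k) : Prop :=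
  ∀ (v : Fin k → ℝ) (i : Fin k), v i ≤ v (a v)

/-- The duality map on a single layer. For `q = 2` all nonzero singular values are replaced by `1`,
for `q = ∞` the sign of a largest entry of each row is kept; the result is multiplied by the
dual norm. -/
def matDuality {n : ℕ} (rowRule : (Fin n → ℝ) → Fin n) :
    QNorm → Matrix (Fin n) (Fin n) ℝ → Matrix (Fin n) (Fin n) ℝ
  | .two, l => matDualNorm .two l •
      ∑ i : Fin n with i.val < l.rank,
        Matrix.vecMulVec (fun j => svdLeft l j i) (fun j => svdRight l j i)
  | .infty, l => matDualNorm .infty l •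
      Matrix.of fun i j => if j = rowRule (fun k => |l i k|) then Real.sign (l i j) else 0

/-! ### The network and its empirical error -/

/-- The parameter space: `w k i j` is the weight, in layer `k`, from node `j` to node `i`. Layers are
indexed from `0`. -/
abbrev Weights (K n : ℕ) : Type := Fin K → Fin n → Fin n → ℝ

/-- The output of the network with activation `σ` and weights `w` on the input `y`. -/
def netOutput {K n : ℕ} (σ : ℝ → ℝ) (w : Weights K n) (y : Fin n → ℝ) : Fin n → ℝ :=
  Fin.induction (motive := fun _ => Fin n → ℝ) y
    (fun k x i => σ (∑ j, w k i j * x j)) (Fin.last K)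

/-- The mean of the squared Euclidean errors over the training pairs `(y i, z i)`. -/
def empError {K n m : ℕ} (σ : ℝ → ℝ) (y z : Fin m → Fin n → ℝ) (w : Weights K n) : ℝ :=
  1 / (m : ℝ) * ∑ i, ∑ c, (netOutput σ w (y i) c - z i c) ^ 2

/-! ### The layer polynomials -/

/-- The supremum norm of a real function. -/
def supAbs (g : ℝ → ℝ) : ℝ := ⨆ u, |g u|

def constC (n : ℕ) : QNorm → ℝ
  | .two => √n
  | .infty => 1

def constD1 (n : ℕ) : QNorm → ℝ
  | .two => 4 * √n
  | .infty => 4 * n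

def constD2 (n : ℕ) : QNorm → ℝ
  | .two => 2
  | .infty => 2 * n

/-- `r_k(z_1, …, z_k)`, with `z j` standing for `z_{j+1}`. -/
def polyR (σ : ℝ → ℝ) (k : ℕ) (z : ℕ → ℝ) : ℝ :=
  supAbs (deriv σ) ^ k * ∏ j ∈ Finset.range k, z j

/-- `v_k(z_1, …, z_k)`, with `z j` standing for `z_{j+1}`. -/
def polyV (σ : ℝ → ℝ) : ℕ → (ℕ → ℝ) → ℝ
  | 0, _ => 0
  | k + 1, z =>
      supAbs (deriv (deriv σ)) * z k ^ 2 * supAbs (deriv σ) ^ (2 * k) *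
          ∏ j ∈ Finset.range k, z j ^ 2 +
        supAbs (deriv σ) * z k * polyV σ k z

/-- `s_k(z_1, …, z_k)`, with `z j` standing for `z_{j+1}`. -/
def polyS (n : ℕ) (q : QNorm) (σ : ℝ → ℝ) (k : ℕ) (z : ℕ → ℝ) : ℝ :=
  constD2 n q * constC n q ^ 2 * supAbs (deriv σ) ^ 2 * polyR σ k z ^ 2 +
    constD1 n q * constC n q ^ 2 * supAbs (deriv σ) ^ 2 * polyV σ k z +
    constD1 n q * constC n q ^ 2 * supAbs (deriv (deriv σ)) * polyR σ k z

/-- The norms of the weights in the layers above layer `i`: entry `j` is the norm in layer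
`i + 1 + j`. Only the entries with `i + 1 + j < K` matter. -/
def upperNorms {K n : ℕ} (q : QNorm) (w : Weights K n) (i : Fin K) (j : ℕ) : ℝ :=
  if h : i.val + 1 + j < K then matNorm q (Matrix.of (w ⟨i.val + 1 + j, h⟩)) else 0

/-- The factor `p_i(w)`; there are `K - 1 - i` layers above layer `i` when layers are counted
from `0`. -/
def layerP {K n : ℕ} (q : QNorm) (σ : ℝ → ℝ) (w : Weights K n) (i : Fin K) : ℝ :=
  √(polyS n q σ (K - 1 - i.val) (upperNorms q w i) + 1)

/-! ### The Finsler structure, the duality structure and the training algorithm -/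

/-- The norm `∑ i, p_i(w) ‖u_i‖_q`. -/
def netNorm {K n : ℕ} (q : QNorm) (σ : ℝ → ℝ) (w u : Weights K n) : ℝ :=
  ∑ i, layerP q σ w i * matNorm q (Matrix.of (u i))

/-- The component of a linear functional that belongs to layer `i`, as the matrix of its values on
the elementary matrices. -/
def layerComp {K n : ℕ} (l : Weights K n →L[ℝ] ℝ) (i : Fin K) : Matrix (Fin n) (Fin n) ℝ :=
  Matrix.of fun a b => l (Pi.single i (Pi.single a (Pi.single b 1)))

/-- The layer that maximizes `‖l_i‖_q / p_i(w)`. -/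
def bestLayer {K n : ℕ} (q : QNorm) (σ : ℝ → ℝ) (layerRule : (Fin K → ℝ) → Fin K)
    (w : Weights K n) (l : Weights K n →L[ℝ] ℝ) : Fin K :=
  layerRule fun i => 1 / layerP q σ w i * matDualNorm q (layerComp l i)

/-- The duality structure on the parameter space: only the selected layer is nonzero. -/
def netDuality {K n : ℕ} (q : QNorm) (σ : ℝ → ℝ) (layerRule : (Fin K → ℝ) → Fin K)
    (rowRule : (Fin n → ℝ) → Fin n) (w : Weights K n) (l : Weights K n →L[ℝ] ℝ) : Weights K n :=
  Pi.single (bestLayer q σ layerRule w l)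
    (fun a b => 1 / layerP q σ w (bestLayer q σ layerRule w l) ^ 2 *
      matDuality rowRule q (layerComp l (bestLayer q σ layerRule w l)) a b)

/-- The sequence `w(1), w(2), …` is generated by the layer-wise training algorithm in batch mode with
constant step size `ε`: the selected layer is updated, and the other layers are copied
(the value `w 0` is not used). -/
def IsBatchRun {K n m : ℕ} (q : QNorm) (σ : ℝ → ℝ) (y z : Fin m → Fin n → ℝ)
    (layerRule : (Fin K → ℝ) → Fin K) (rowRule : (Fin n → ℝ) → Fin n) (ε : ℝ)
    (w : ℕ → Weights K n) : Prop :=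
  ∀ t, 1 ≤ t →
    let g := fderiv ℝ (empError σ y z) (w t)
    let i₀ := layerRule fun i => 1 / layerP q σ (w t) i * matDualNorm q (layerComp g i)
    (∀ a b, w (t + 1) i₀ a b =
      w t i₀ a b - ε * (1 / layerP q σ (w t) i₀ ^ 2) * matDuality rowRule q (layerComp g i₀) a b) ∧
    ∀ i, i ≠ i₀ → w (t + 1) i = w t i

end

end NetDSGD

open NetDSGD

/-! The gradient of `f` is not globally Lipschitz, but each step changes a single layer `i`. Since
`|σ| ≤ 1`, the input of that layer is bounded whatever the lower layers are, and moving `w_i` leaves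
it fixed. The first two derivatives of the output along a line in `w_i` are therefore bounded by
polynomials in the norms of the layers above `i` only, and these do not change along the line. This
gives a bound `p_i(w)² ‖u_i‖²` on the second derivative of `f` along the whole line, hence a
quadratic upper model (`exists_derivs_netLayer`, `empError_add_single_le`).

A duality map for the weighted sum norm picks the layer maximizing `‖ℓ_i‖ / p_i` and a vector
attaining the dual norm there (`exists_matDuality_eq_smul`, `dualNorm_netNorm_eq`). Put into the
quadratic model, a step of size `ε` lowers `f` by at least `ε(2-ε)/2` times the squared dual norm of
the derivative. As `f ≥ 0`, these squares have a finite sum, and all convergence claims follow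
(`convergence_of_sufficient_decrease`). -/

namespace NetDSGD

open Matrix

/-! ### Descent along a duality structure -/

/-- A function whose second derivative is at most `C` lies below its quadratic Taylor model. -/
theorem le_taylor_of_second_deriv_le {φ φ₁ φ₂ : ℝ → ℝ} {C : ℝ}
    (h₁ : ∀ t, HasDerivAt φ (φ₁ t) t) (h₂ : ∀ t, HasDerivAt φ₁ (φ₂ t) t) (hC : ∀ t, φ₂ t ≤ C) :
    φ 1 ≤ φ 0 + φ₁ 0 + C / 2 := by
  -- Two monotonicity arguments replace integration, so `φ₂` need not be continuous or even
  -- integrable.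
  have hχ : Antitone fun t => φ₁ t - C * t := by
    have hd : ∀ t, HasDerivAt (fun t => φ₁ t - C * t) (φ₂ t - C) t := fun t => by
      simpa using (h₂ t).fun_sub ((hasDerivAt_id' t).const_mul C)
    refine antitone_of_deriv_nonpos (fun t => (hd t).differentiableAt) fun t => ?_
    rw [(hd t).deriv]
    linarith [hC t]
  have hd : ∀ t, HasDerivAt (fun t => φ t - φ₁ 0 * t - C / 2 * t ^ 2)
      (φ₁ t - φ₁ 0 - C * t) t := fun t => by
    refine (((h₁ t).fun_sub ((hasDerivAt_id' t).const_mul (φ₁ 0))).fun_sub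
      ((hasDerivAt_pow 2 t).const_mul (C / 2))).congr_deriv ?_
    push_cast
    ring
  have hψ : AntitoneOn (fun t => φ t - φ₁ 0 * t - C / 2 * t ^ 2) (Set.Icc 0 1) := by
    refine antitoneOn_of_deriv_nonpos (convex_Icc 0 1)
      (fun t _ => (hd t).continuousAt.continuousWithinAt)
      (fun t _ => (hd t).differentiableAt.differentiableWithinAt) fun t ht => ?_
    rw [interior_Icc] at ht
    rw [(hd t).deriv]
    have := hχ ht.1.le
    simp only [mul_zero, sub_zero] at this
    linarith
  have := hψ (Set.left_mem_Icc.2 zero_le_one) (Set.right_mem_Icc.2 zero_le_one) zero_le_one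
  norm_num at this
  linarith

section Abstract

variable {E : Type*} [NormedAddCommGroup E] [NormedSpace ℝ E]

/-- A vector on which `l` attains the bound `C` in the manner of a duality map shows that `C` is the
dual norm. -/
theorem dualNorm_eq_of_attained {N : E → E → ℝ} (hN : IsFinslerStructure N) [Nontrivial E] {w : E}
    {l : E →L[ℝ] ℝ} {C : ℝ} (hC : 0 ≤ C) (hle : ∀ u, l u ≤ C * N w u) {r : E} (hr : N w r = C)
    (hlr : l r = C ^ 2) : dualNorm N w l = C := by
  refine IsGreatest.csSup_eq ⟨?_, ?_⟩
  -- If `C = 0`, then `r = 0` cannot be normalized. But `l` vanishes identically, so any unit vector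
  -- attains the supremum; this is where nontriviality of `E` enters.
  · rcases hC.eq_or_lt with rfl | hpos
    · obtain ⟨u, hu⟩ := exists_ne (0 : E)
      have hNu : N w u ≠ 0 := fun h => hu ((hN.eq_zero_iff w u).1 h)
      refine ⟨(N w u)⁻¹ • u, ?_, ?_⟩
      · rw [hN.smul, abs_of_nonneg (inv_nonneg.2 (hN.nonneg w u)), inv_mul_cancel₀ hNu]
      · have h1 := hle ((N w u)⁻¹ • u)
        have h2 := hle (-((N w u)⁻¹ • u))
        rw [map_neg] at h2
        linarith
    · refine ⟨C⁻¹ • r, ?_, ?_⟩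
      · rw [hN.smul, hr, abs_of_pos (inv_pos.2 hpos), inv_mul_cancel₀ hpos.ne']
      · rw [map_smul, hlr, smul_eq_mul]
        field_simp
  · rintro a ⟨u, hu, rfl⟩
    simpa [hu] using hle u

/-- The conclusions of duality structure gradient descent, from the sufficient decrease of the
objective in every step. -/
theorem convergence_of_sufficient_decrease {N : E → E → ℝ} (hN : IsFinslerStructure N)
    {f : E → ℝ} (hf : ContDiff ℝ 1 f) (hf0 : ∀ x, 0 ≤ f x)
    (hdual : ∀ w (l : E →L[ℝ] ℝ) u, l u ≤ dualNorm N w l * N w u)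
    (hdual0 : ∀ w (l : E →L[ℝ] ℝ), 0 ≤ dualNorm N w l)
    {ε : ℝ} (hε : ε ∈ Set.Ioo (0 : ℝ) 2) {w : ℕ → E}
    (hdec : ∀ t, 1 ≤ t →
      f (w (t + 1)) ≤ f (w t) - ε * (2 - ε) / 2 * dualNorm N (w t) (fderiv ℝ f (w t)) ^ 2) :
    (FiniteTermination f w ∨ AsymptoticConvergence N f w) ∧
    ∀ δ : ℝ, 0 < δ → ∀ T : ℕ, 1 ≤ T →
      1 / δ ^ 2 * (2 / (ε * (2 - ε))) * f (w 1) ≤ (T : ℝ) →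
      ∃ t, 1 ≤ t ∧ t ≤ T ∧ dualNorm N (w t) (fderiv ℝ f (w t)) ≤ δ := by
  set d : ℕ → ℝ := fun t => dualNorm N (w t) (fderiv ℝ f (w t)) with hd
  set c : ℝ := ε * (2 - ε) / 2 with hc
  have hcpos : 0 < c := by
    have := mul_pos hε.1 (sub_pos.2 hε.2)
    positivity
  -- Telescoped decrease; the shift by one is there because the sequence starts at `w 1`.
  have hsum : ∀ T, f (w (T + 1)) + c * ∑ t ∈ Finset.range T, d (t + 1) ^ 2 ≤ f (w 1) := by
    intro T
    induction T with
    | zero => simp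
    | succ T ih =>
      rw [Finset.sum_range_succ, mul_add]
      have := hdec (T + 1) (by omega)
      simp only [hd] at ih ⊢
      linarith
  have hzero : ∀ t, d t = 0 → fderiv ℝ f (w t) = 0 := by
    intro t ht
    ext u
    have h1 := hdual (w t) (fderiv ℝ f (w t)) u
    have h2 := hdual (w t) (fderiv ℝ f (w t)) (-u)
    simp only [hd] at ht
    rw [ht, zero_mul] at h1 h2
    rw [map_neg] at h2
    simp only [_root_.zero_apply]
    linarith
  have hstep : ∀ t, 1 < t → fderiv ℝ f (w (t - 1)) ≠ 0 → f (w t) < f (w (t - 1)) := by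
    intro t ht hne
    have hpos : 0 < d (t - 1) := lt_of_le_of_ne (hdual0 _ _) fun h => hne (hzero _ h.symm)
    have := hdec (t - 1) (by omega)
    rw [Nat.sub_add_cancel ht.le] at this
    have h3 : 0 < c * d (t - 1) ^ 2 := by positivity
    simp only [hd] at h3
    linarith
  refine ⟨?_, ?_⟩
  · by_cases hex : ∃ T, 1 ≤ T ∧ fderiv ℝ f (w T) = 0
    · left
      classical
      -- Taking the first stationary time makes every earlier step a strict decrease.
      obtain ⟨h1, h0⟩ := Nat.find_spec hex
      refine ⟨Nat.find hex, h1, fun t ht htT => hstep t ht fun h => ?_, h0⟩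
      exact Nat.find_min hex (m := t - 1) (by omega) ⟨by omega, h⟩
    · right
      push Not at hex
      have hlim : Filter.Tendsto d Filter.atTop (nhds 0) := by
        have hs : Summable fun t => d (t + 1) ^ 2 := by
          refine summable_of_sum_range_le (c := f (w 1) / c) (fun t => sq_nonneg _) fun T => ?_
          rw [le_div_iff₀ hcpos]
          linarith [hsum T, hf0 (w (T + 1))]
        have h2 :=
          (Filter.tendsto_add_atTop_iff_nat (f := fun t => d t ^ 2) 1).1 hs.tendsto_atTop_zero
        have h3 := (Real.continuous_sqrt.tendsto 0).comp h2
        rw [Real.sqrt_zero] at h3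
        refine h3.congr fun t => ?_
        exact Real.sqrt_sq (hdual0 _ _)
      refine ⟨fun t ht => hstep t ht (hex (t - 1) (by omega)), hlim, fun v hv => ?_⟩
      obtain ⟨ψ, hψ, hψv⟩ := hv.tendsto_subseq
      -- Passing to the limit with `u` fixed uses only continuity of `N` in the base point;
      -- continuity of the dual norm is not needed. Using both `u` and `-u` then gives zero.
      have hle : ∀ u, fderiv ℝ f v u ≤ 0 := by
        intro u
        have hl : Filter.Tendsto (fun k => fderiv ℝ f (w (ψ k)) u) Filter.atTop
            (nhds (fderiv ℝ f v u)) :=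
          (((hf.continuous_fderiv one_ne_zero).clm_apply continuous_const).tendsto v).comp hψv
        have hr : Filter.Tendsto (fun k => d (ψ k) * N (w (ψ k)) u) Filter.atTop (nhds 0) := by
          have hNc : Continuous fun x => N x u := 
            hN.continuous.comp (continuous_id.prodMk continuous_const)
          have := (hlim.comp hψ.tendsto_atTop).mul ((hNc.tendsto v).comp hψv)
          rwa [zero_mul] at this
        exact le_of_tendsto_of_tendsto' hl hr fun k => hdual _ _ _
      ext u
      have h2 := hle (-u)
      rw [map_neg] at h2
      simp only [_root_.zero_apply]
      linarith [hle u]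
  · intro δ hδ T hT hTle
    by_contra! hcon
    -- If all `T` dual norms exceeded `δ`, the total decrease would exceed `c T δ² ≥ f (w 1)`,
    -- against `f ≥ 0`.
    have hlt : (T : ℝ) * δ ^ 2 < ∑ t ∈ Finset.range T, d (t + 1) ^ 2 := by
      have : ∑ t ∈ Finset.range T, δ ^ 2 < ∑ t ∈ Finset.range T, d (t + 1) ^ 2 := by
        refine Finset.sum_lt_sum_of_nonempty (by simp; omega) fun t ht => ?_
        have := hcon (t + 1) (by omega) (by simpa using ht)
        exact pow_lt_pow_left₀ this hδ.le two_ne_zero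
      simpa using this
    have h1 : f (w 1) ≤ c * (T * δ ^ 2) := by
      have h4 : 1 / δ ^ 2 * (2 / (ε * (2 - ε))) * f (w 1) = f (w 1) / (c * δ ^ 2) := by
        rw [hc]
        have h5 := hε.1.ne'
        have h6 := (sub_pos.2 hε.2).ne'
        field_simp
      rw [h4, div_le_iff₀ (by positivity)] at hTle
      linarith
    have h2 := hsum T
    have h3 := hf0 (w (T + 1))
    have h4 := mul_lt_mul_of_pos_left hlt hcpos
    linarith

end Abstract

/-! ### Vector norms -/

/-- The vector norm that induces `matNorm q`. -/
noncomputable def vecNorm {n : ℕ} : QNorm → (Fin n → ℝ) → ℝ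
  | .two, v => ‖WithLp.toLp 2 v‖
  | .infty, v => ‖v‖

section Vector

variable {n : ℕ} (q : QNorm)

theorem vecNorm_nonneg (v : Fin n → ℝ) : 0 ≤ vecNorm q v := by
  cases q <;> exact norm_nonneg _

theorem vecNorm_add_le (u v : Fin n → ℝ) : vecNorm q (u + v) ≤ vecNorm q u + vecNorm q v := by
  cases q <;> exact norm_add_le _ _

theorem vecNorm_smul (c : ℝ) (v : Fin n → ℝ) : vecNorm q (c • v) = |c| * vecNorm q v := by
  cases q
  · exact norm_smul c (WithLp.toLp 2 v)
  · exact norm_smul c v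

theorem vecNorm_mono {u v : Fin n → ℝ} (h : ∀ i, |u i| ≤ |v i|) : vecNorm q u ≤ vecNorm q v := by
  cases q with
  | two =>
    simp only [vecNorm, EuclideanSpace.norm_eq, Real.norm_eq_abs]
    exact Real.sqrt_le_sqrt (Finset.sum_le_sum fun i _ => pow_le_pow_left₀ (abs_nonneg _) (h i) 2)
  | infty =>
    exact (pi_norm_le_iff_of_nonneg (norm_nonneg _)).2 fun i => (h i).trans (norm_le_pi_norm v i)

theorem abs_le_vecNorm (v : Fin n → ℝ) (i : Fin n) : |v i| ≤ vecNorm q v := by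
  cases q with
  | two => exact PiLp.norm_apply_le (WithLp.toLp 2 v) i
  | infty => exact norm_le_pi_norm v i

theorem vecNorm_mul_le {S : ℝ} {s : Fin n → ℝ} (hs : ∀ i, |s i| ≤ S) (v : Fin n → ℝ) :
    vecNorm q (fun i => s i * v i) ≤ S * vecNorm q v := by
  by_cases hn : Nonempty (Fin n)
  · have hS : 0 ≤ S := (abs_nonneg _).trans (hs hn.some)
    rw [← abs_of_nonneg hS, ← vecNorm_smul]
    refine vecNorm_mono q fun i => ?_
    rw [Pi.smul_apply, smul_eq_mul, abs_mul, abs_mul, abs_of_nonneg hS]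
    gcongr
    exact hs i
  -- For an empty index set `S` may be negative, but every vector has norm zero.
  · have hv : ∀ v : Fin n → ℝ, vecNorm q v = 0 := fun v => by
      have : v = (0 : ℝ) • v := funext fun i => (hn ⟨i⟩).elim
      rw [this, vecNorm_smul, abs_zero, zero_mul]
    rw [hv, hv, mul_zero]

theorem vecNorm_mul_sq_le {S : ℝ} {s : Fin n → ℝ} (hs : ∀ i, |s i| ≤ S) (v : Fin n → ℝ) :
    vecNorm q (fun i => s i * v i ^ 2) ≤ S * vecNorm q v ^ 2 := by
  -- The multiplier is `v` itself: each of its entries is at most its norm.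
  have h : vecNorm q (fun i => v i * v i) ≤ vecNorm q v * vecNorm q v :=
    vecNorm_mul_le q (abs_le_vecNorm q v) v
  refine (vecNorm_mul_le q hs fun i => v i ^ 2).trans ?_
  by_cases hn : Nonempty (Fin n)
  · have hS : 0 ≤ S := (abs_nonneg _).trans (hs hn.some)
    simp only [pow_two]
    gcongr
  · have hv : ∀ v : Fin n → ℝ, vecNorm q v = 0 := fun v => by
      have : v = (0 : ℝ) • v := funext fun i => (hn ⟨i⟩).elim
      rw [this, vecNorm_smul, abs_zero, zero_mul]
    simp [hv]

theorem norm_toLp_const_one : ‖WithLp.toLp 2 (fun _ : Fin n => (1 : ℝ))‖ = √n := by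
  simp [EuclideanSpace.norm_eq]

theorem vecNorm_le_constC {x : Fin n → ℝ} (hx : ∀ i, |x i| ≤ 1) : vecNorm q x ≤ constC n q := by
  cases q with
  | two =>
    refine (vecNorm_mono .two (v := fun _ => 1) fun i => by simpa using hx i).trans ?_
    exact norm_toLp_const_one.le
  | infty => exact (pi_norm_le_iff_of_nonneg zero_le_one).2 hx

/-- Origin of `d_{q,2}`: this controls the squared-first-derivative part of the second derivative of
the squared error. -/
theorem two_mul_sum_sq_le (v : Fin n → ℝ) : 2 * ∑ i, v i ^ 2 ≤ constD2 n q * vecNorm q v ^ 2 := by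
  cases q with
  | two => simp [constD2, vecNorm, EuclideanSpace.norm_sq_eq]
  | infty =>
    have : ∑ i, v i ^ 2 ≤ ∑ _i : Fin n, ‖v‖ ^ 2 := by
      refine Finset.sum_le_sum fun i _ => ?_
      exact sq_le_sq' (abs_le.1 (norm_le_pi_norm v i)).1 (abs_le.1 (norm_le_pi_norm v i)).2
    simp only [Finset.sum_const, Finset.card_univ, Fintype.card_fin, nsmul_eq_mul] at this
    simp only [constD2, vecNorm]
    linarith

/-- Origin of `d_{q,1}`: residual entries are at most `2`, so Cauchy–Schwarz gives `4√n` for `q = 2`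
and summing entrywise gives `4n` for `q = ∞`. -/
theorem two_mul_sum_mul_le {e : Fin n → ℝ} (he : ∀ i, |e i| ≤ 2) (a : Fin n → ℝ) :
    2 * ∑ i, e i * a i ≤ constD1 n q * vecNorm q a := by
  cases q with
  | two =>
    have h1 : vecNorm .two e ≤ 2 * √n := by
      refine (vecNorm_mono .two (v := (2 : ℝ) • fun _ => (1 : ℝ)) fun i => ?_).trans ?_
      · simpa using he i
      · rw [vecNorm_smul, abs_two]
        exact mul_le_mul_of_nonneg_left norm_toLp_const_one.le zero_le_two
    have h2 := real_inner_le_norm (WithLp.toLp 2 a) (WithLp.toLp 2 e)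
    rw [PiLp.inner_apply] at h2
    simp only [RCLike.inner_apply, conj_trivial] at h2
    have h3 := mul_le_mul_of_nonneg_left h1 (vecNorm_nonneg .two a)
    simp only [constD1]
    simp only [vecNorm] at h3 ⊢
    linarith
  | infty =>
    have : ∑ i, e i * a i ≤ ∑ _i : Fin n, 2 * ‖a‖ := by
      refine Finset.sum_le_sum fun i _ => (le_abs_self _).trans ?_
      rw [abs_mul]
      exact mul_le_mul (he i) (norm_le_pi_norm a i) (abs_nonneg _) zero_le_two
    simp only [Finset.sum_const, Finset.card_univ, Fintype.card_fin, nsmul_eq_mul] at this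
    simp only [constD1, vecNorm]
    linarith

end Vector

/-! ### Matrix norms -/

section MatrixNorm

variable {n : ℕ} (q : QNorm)

/-- Writing the row-sum norm as a sup norm of a vector lets the norm axioms and continuity be
inherited. -/
theorem matNorm_infty_eq (A : Matrix (Fin n) (Fin n) ℝ) :
    matNorm .infty A = ‖fun i => ∑ j, |A i j|‖ := by
  have h0 : ∀ i, 0 ≤ ∑ j, |A i j| := fun i => Finset.sum_nonneg fun j _ => abs_nonneg _
  refine le_antisymm (Real.iSup_le (fun i => ?_) (norm_nonneg _))
    ((pi_norm_le_iff_of_nonneg (Real.iSup_nonneg h0)).2 fun i => ?_)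
  · exact (le_abs_self _).trans (norm_le_pi_norm (fun i => ∑ j, |A i j|) i)
  · rw [Real.norm_of_nonneg (h0 i)]
    exact le_ciSup (f := fun i => ∑ j, |A i j|) (Set.finite_range _).bddAbove i

theorem matNorm_nonneg (A : Matrix (Fin n) (Fin n) ℝ) : 0 ≤ matNorm q A := by
  cases q with
  | two => exact norm_nonneg _
  | infty => rw [matNorm_infty_eq]; exact norm_nonneg _

theorem matNorm_eq_zero_iff (A : Matrix (Fin n) (Fin n) ℝ) : matNorm q A = 0 ↔ A = 0 := by
  cases q with
  | two => simp [matNorm]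
  | infty =>
    rw [matNorm_infty_eq, norm_eq_zero]
    refine ⟨fun h => ?_, fun h => by ext i; simp [h]⟩
    ext i j
    have hi := (Finset.sum_eq_zero_iff_of_nonneg fun j _ => abs_nonneg (A i j)).1 (congrFun h i)
    exact abs_eq_zero.1 (hi j (Finset.mem_univ j))

theorem matNorm_smul (c : ℝ) (A : Matrix (Fin n) (Fin n) ℝ) :
    matNorm q (c • A) = |c| * matNorm q A := by
  cases q with
  | two => simp [matNorm, norm_smul]
  | infty =>
    rw [matNorm_infty_eq, matNorm_infty_eq]
    have : (fun i => ∑ j, |(c • A) i j|) = |c| • fun i => ∑ j, |A i j| := by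
      ext i
      simp [abs_mul, Finset.mul_sum]
    rw [this, norm_smul, Real.norm_eq_abs, abs_abs]

theorem matNorm_add_le (A B : Matrix (Fin n) (Fin n) ℝ) :
    matNorm q (A + B) ≤ matNorm q A + matNorm q B := by
  cases q with
  | two =>
    simp only [matNorm, map_add]
    exact norm_add_le _ _
  | infty =>
    rw [matNorm_infty_eq A, matNorm_infty_eq B, matNorm_infty_eq]
    refine le_trans ?_ (norm_add_le _ _)
    refine vecNorm_mono .infty fun i => ?_
    rw [abs_of_nonneg (Finset.sum_nonneg fun j _ => abs_nonneg _), Pi.add_apply,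
      ← Finset.sum_add_distrib]
    exact (Finset.sum_le_sum fun j _ => abs_add_le _ _).trans (le_abs_self _)

theorem continuous_matNorm : Continuous (matNorm (n := n) q) := by
  cases q with
  | two =>
    exact continuous_norm.comp (LinearMap.continuous_of_finiteDimensional
      (Matrix.toEuclideanCLM (n := Fin n) (𝕜 := ℝ)).toAlgEquiv.toLinearMap)
  | infty =>
    rw [funext matNorm_infty_eq]
    refine continuous_norm.comp (continuous_pi fun i => continuous_finsetSum _ fun j _ => ?_)
    exact (continuous_id.matrix_elem i j).abs

theorem vecNorm_mulVec_le (A : Matrix (Fin n) (Fin n) ℝ) (v : Fin n → ℝ) :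
    vecNorm q (A *ᵥ v) ≤ matNorm q A * vecNorm q v := by
  cases q with
  | two => exact (Matrix.toEuclideanCLM (n := Fin n) (𝕜 := ℝ) A).le_opNorm (WithLp.toLp 2 v)
  | infty =>
    refine (pi_norm_le_iff_of_nonneg
      (mul_nonneg (matNorm_nonneg .infty A) (norm_nonneg v))).2 fun i => ?_
    have h1 : ∑ j, |A i j| ≤ matNorm .infty A :=
      le_ciSup (f := fun i => ∑ j, |A i j|) (Set.finite_range _).bddAbove i
    calc ‖(A *ᵥ v) i‖ ≤ ∑ j, |A i j * v j| := by
          rw [Real.norm_eq_abs, Matrix.mulVec, dotProduct]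
          exact Finset.abs_sum_le_sum_abs _ _
      _ ≤ ∑ j, |A i j| * ‖v‖ := by
        gcongr with j
        rw [abs_mul]
        gcongr
        exact norm_le_pi_norm v j
      _ ≤ matNorm .infty A * ‖v‖ := by
        rw [← Finset.sum_mul]
        gcongr

end MatrixNorm

/-! ### The duality map on a single layer -/

section Duality

variable {n : ℕ}

theorem sum_mul_eq_trace (l A : Matrix (Fin n) (Fin n) ℝ) :
    ∑ i, ∑ j, l i j * A i j = (lᵀ * A).trace := by
  simp only [Matrix.trace, Matrix.diag_apply, Matrix.mul_apply, Matrix.transpose_apply]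
  exact Finset.sum_comm

theorem singVal_nonneg (l : Matrix (Fin n) (Fin n) ℝ) (i : Fin n) : 0 ≤ singVal l i :=
  LinearMap.singularValues_nonneg _ _

/-- Cutting the sum in the duality map off at the rank therefore loses nothing in the pairing with
`l`. -/
theorem singVal_eq_zero_of_rank_le {l : Matrix (Fin n) (Fin n) ℝ} {i : Fin n}
    (h : l.rank ≤ i.val) : singVal l i = 0 := by
  rw [singVal, LinearMap.singularValues_eq_zero_iff_le_finrank_range, Matrix.toEuclideanLin,
    Matrix.toLpLin_eq_toLin, ← Matrix.rank_eq_finrank_range_toLin]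
  exact h

theorem isSVD_svd (l : Matrix (Fin n) (Fin n) ℝ) : IsSVD l (svdLeft l) (svdRight l) :=
  (exists_isSVD l).choose_spec.choose_spec

theorem matNorm_two_mul_le (A B : Matrix (Fin n) (Fin n) ℝ) :
    matNorm .two (A * B) ≤ matNorm .two A * matNorm .two B := by
  simp only [matNorm, map_mul]
  exact norm_mul_le _ _

theorem matNorm_two_transpose (A : Matrix (Fin n) (Fin n) ℝ) :
    matNorm .two Aᵀ = matNorm .two A := by
  have := Matrix.l2_opNorm_conjTranspose A
  rwa [Matrix.conjTranspose_eq_transpose_of_trivial] at this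

/-- From `‖UᵀU‖ = ‖U‖²`. Equality fails for `n = 0`, where the identity has norm zero. -/
theorem matNorm_two_orthogonal_le {U : Matrix (Fin n) (Fin n) ℝ}
    (hU : U ∈ Matrix.orthogonalGroup (Fin n) ℝ) : matNorm .two U ≤ 1 := by
  have h := Matrix.l2_opNorm_conjTranspose_mul_self U
  rw [Matrix.conjTranspose_eq_transpose_of_trivial,
    (Matrix.mem_orthogonalGroup_iff' (Fin n) ℝ).1 hU] at h
  have h1 : matNorm .two (1 : Matrix (Fin n) (Fin n) ℝ) ≤ 1 := by
    simp only [matNorm, map_one]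
    exact ContinuousLinearMap.norm_id_le
  have h2 : matNorm .two U * matNorm .two U ≤ 1 := h.symm.trans_le h1
  nlinarith [matNorm_nonneg .two U]

theorem diag_le_matNorm_two (A : Matrix (Fin n) (Fin n) ℝ) (i : Fin n) :
    A i i ≤ matNorm .two A := by
  have h1 := (abs_le_vecNorm .two (A *ᵥ Pi.single i 1) i).trans (vecNorm_mulVec_le .two A _)
  have h2 : vecNorm .two (Pi.single i (1 : ℝ)) = 1 := by simp [vecNorm]
  rw [h2, mul_one, Matrix.mulVec_single_one] at h1
  exact (le_abs_self _).trans h1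

/-- The pairing of matrices is bounded by the dual norm times the norm. -/
theorem sum_mul_le (q : QNorm) (l A : Matrix (Fin n) (Fin n) ℝ) :
    ∑ i, ∑ j, l i j * A i j ≤ matDualNorm q l * matNorm q A := by
  cases q with
  | two =>
    obtain ⟨U, V, hU, hV, h⟩ := exists_isSVD l
    -- Cyclicity of the trace moves the orthogonal factors onto `A`; then only diagonal entries of
    -- `UᵀAV` meet the singular values, and each is at most `‖A‖`.
    have htr : ∑ i, ∑ j, l i j * A i j = ∑ k, singVal l k * (Uᵀ * A * V) k k := by
      rw [sum_mul_eq_trace]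
      conv_lhs => rw [h]
      rw [Matrix.transpose_mul, Matrix.transpose_mul, Matrix.transpose_transpose,
        Matrix.diagonal_transpose, Matrix.mul_assoc, Matrix.trace_mul_comm, Matrix.mul_assoc,
        Matrix.mul_assoc, ← Matrix.mul_assoc Uᵀ]
      simp [Matrix.trace, Matrix.diagonal_mul]
    rw [htr, matDualNorm, Finset.sum_mul]
    gcongr with k
    · exact singVal_nonneg l k
    · refine (diag_le_matNorm_two _ k).trans ?_
      have h1 := matNorm_two_orthogonal_le hU
      have h2 := matNorm_two_orthogonal_le hV
      rw [← matNorm_two_transpose] at h1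
      calc matNorm .two (Uᵀ * A * V)
          ≤ matNorm .two (Uᵀ * A) * matNorm .two V := matNorm_two_mul_le _ _
        _ ≤ matNorm .two (Uᵀ * A) * 1 := by gcongr; exact matNorm_nonneg _ _
        _ ≤ matNorm .two Uᵀ * matNorm .two A := by rw [mul_one]; exact matNorm_two_mul_le _ _
        _ ≤ 1 * matNorm .two A := by gcongr; exact matNorm_nonneg _ _
        _ = matNorm .two A := one_mul _
  | infty =>
    rw [matDualNorm, Finset.sum_mul]
    refine Finset.sum_le_sum fun i _ => ?_
    have h1 : ∑ j, |A i j| ≤ matNorm .infty A :=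
      le_ciSup (f := fun i => ∑ j, |A i j|) (Set.finite_range _).bddAbove i
    have h2 : ∀ j, |l i j| ≤ ⨆ j, |l i j| := fun j =>
      le_ciSup (f := fun j => |l i j|) (Set.finite_range _).bddAbove j
    calc ∑ j, l i j * A i j ≤ ∑ j, (⨆ j, |l i j|) * |A i j| := by
          refine Finset.sum_le_sum fun j _ => (le_abs_self _).trans ?_
          rw [abs_mul]
          gcongr
          exact h2 j
      _ ≤ (⨆ j, |l i j|) * matNorm .infty A := by
          rw [← Finset.mul_sum]
          gcongr
          exact Real.iSup_nonneg fun j => abs_nonneg _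

theorem matDualNorm_nonneg (q : QNorm) (l : Matrix (Fin n) (Fin n) ℝ) : 0 ≤ matDualNorm q l := by
  cases q with
  | two => exact Finset.sum_nonneg fun i _ => singVal_nonneg l i
  | infty => exact Finset.sum_nonneg fun i _ => Real.iSup_nonneg fun j => abs_nonneg _

/-- The duality map is the dual norm times a matrix of norm at most one at which the functional
attains its dual norm. -/
theorem exists_matDuality_eq_smul {rowRule : (Fin n → ℝ) → Fin n} (hrow : IsArgmaxRule rowRule)
    (q : QNorm) (l : Matrix (Fin n) (Fin n) ℝ) :
    ∃ M, matDuality rowRule q l = matDualNorm q l • M ∧ matNorm q M ≤ 1 ∧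
      ∑ i, ∑ j, l i j * M i j = matDualNorm q l := by
  cases q with
  | two =>
    refine ⟨_, rfl, ?_⟩
    obtain ⟨hU, hV, h⟩ := isSVD_svd l
    set U := svdLeft l
    set V := svdRight l
    -- With this indicator, the truncated sum of rank-one matrices is `U diag(χ) Vᵀ`, a product of
    -- three factors of norm at most one.
    set χ : Fin n → ℝ := fun k => if k.val < l.rank then 1 else 0 with hχ
    have hM : (∑ i : Fin n with i.val < l.rank, vecMulVec (fun j => U j i) (fun j => V j i)) =
        U * diagonal χ * Vᵀ := by
      ext a b
      rw [Matrix.sum_apply, Finset.sum_filter, Matrix.mul_apply]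
      refine Finset.sum_congr rfl fun k _ => ?_
      rw [Matrix.mul_diagonal, Matrix.transpose_apply, vecMulVec_apply]
      simp only [hχ]
      split_ifs <;> simp
    rw [hM]
    constructor
    · have h1 := matNorm_two_orthogonal_le hU
      have h2 := matNorm_two_orthogonal_le hV
      rw [← matNorm_two_transpose] at h2
      have h3 : matNorm .two (diagonal χ) ≤ 1 := by
        refine (Matrix.l2_opNorm_diagonal χ).trans_le
          ((pi_norm_le_iff_of_nonneg zero_le_one).2 fun k => ?_)
        simp only [hχ]
        split_ifs <;> simp
      calc matNorm .two (U * diagonal χ * Vᵀ)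
          ≤ matNorm .two (U * diagonal χ) * matNorm .two Vᵀ := matNorm_two_mul_le _ _
        _ ≤ matNorm .two (U * diagonal χ) * 1 := by gcongr; exact matNorm_nonneg _ _
        _ ≤ matNorm .two U * matNorm .two (diagonal χ) := by
          rw [mul_one]; exact matNorm_two_mul_le _ _
        _ ≤ 1 := mul_le_one₀ h1 (matNorm_nonneg _ _) h3
    · rw [sum_mul_eq_trace]
      conv_lhs => rw [h]
      have hUU : Uᵀ * U = 1 := (Matrix.mem_orthogonalGroup_iff' (Fin n) ℝ).1 hU
      have hVV : Vᵀ * V = 1 := (Matrix.mem_orthogonalGroup_iff' (Fin n) ℝ).1 hV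
      rw [Matrix.transpose_mul, Matrix.transpose_mul, Matrix.transpose_transpose,
        Matrix.diagonal_transpose, Matrix.trace_mul_comm]
      have : U * diagonal χ * Vᵀ * (V * (diagonal (singVal l) * Uᵀ)) =
          U * (diagonal χ * diagonal (singVal l) * Uᵀ) := by
        simp only [Matrix.mul_assoc]
        rw [← Matrix.mul_assoc Vᵀ, hVV, Matrix.one_mul]
      rw [this, Matrix.trace_mul_comm, Matrix.mul_assoc, hUU, Matrix.mul_one,
        Matrix.diagonal_mul_diagonal, Matrix.trace_diagonal, matDualNorm]
      refine Finset.sum_congr rfl fun k _ => ?_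
      simp only [hχ]
      split_ifs with hk
      · rw [one_mul]
      · rw [singVal_eq_zero_of_rank_le (not_lt.1 hk), mul_zero]
  | infty =>
    refine ⟨_, rfl, ?_, ?_⟩
    · refine Real.iSup_le (fun i => ?_) zero_le_one
      simp only [Matrix.of_apply, apply_ite, abs_zero, Finset.sum_ite_eq', Finset.mem_univ,
        if_true]
      rcases Real.sign_apply_eq (l i (rowRule fun k => |l i k|)) with h | h | h <;> simp [h]
    · refine Finset.sum_congr rfl fun i _ => ?_
      simp only [Matrix.of_apply, mul_ite, mul_zero, Finset.sum_ite_eq', Finset.mem_univ, if_true]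
      have hne : Nonempty (Fin n) := ⟨i⟩
      set v : Fin n → ℝ := fun k => |l i k|
      have hs : ⨆ j, |l i j| = |l i (rowRule v)| :=
        le_antisymm (ciSup_le (hrow v))
          (le_ciSup (f := v) (Set.finite_range _).bddAbove _)
      rw [hs]
      rcases lt_trichotomy (l i (rowRule v)) 0 with h | h | h
      · rw [Real.sign_of_neg h, abs_of_neg h, mul_neg_one]
      · rw [h, zero_mul, abs_zero]
      · rw [Real.sign_of_pos h, abs_of_pos h, mul_one]

theorem matNorm_matDuality {rowRule : (Fin n → ℝ) → Fin n} (hrow : IsArgmaxRule rowRule)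
    (q : QNorm) (l : Matrix (Fin n) (Fin n) ℝ) :
    matNorm q (matDuality rowRule q l) = matDualNorm q l := by
  obtain ⟨M, hM, h1, h2⟩ := exists_matDuality_eq_smul hrow q l
  rw [hM, matNorm_smul, abs_of_nonneg (matDualNorm_nonneg q l)]
  refine le_antisymm (mul_le_of_le_one_right (matDualNorm_nonneg q l) h1) ?_
  -- Attainment gives `‖l‖ = ⟨l, M⟩ ≤ ‖l‖ ‖M‖`, which also covers `l = 0`, where `M` need not have
  -- norm one.
  exact h2.symm.trans_le (sum_mul_le q l M)

theorem sum_mul_matDuality {rowRule : (Fin n → ℝ) → Fin n} (hrow : IsArgmaxRule rowRule)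
    (q : QNorm) (l : Matrix (Fin n) (Fin n) ℝ) :
    ∑ i, ∑ j, l i j * matDuality rowRule q l i j = matDualNorm q l ^ 2 := by
  obtain ⟨M, hM, -, h2⟩ := exists_matDuality_eq_smul hrow q l
  rw [hM, pow_two]
  nth_rewrite 3 [← h2]
  simp only [Matrix.smul_apply, smul_eq_mul, Finset.mul_sum]
  exact Finset.sum_congr rfl fun i _ => Finset.sum_congr rfl fun j _ => by ring

end Duality

/-! ### The layers of the network -/

section Network

variable {K n : ℕ} {σ : ℝ → ℝ}

/-- The output of layer `k`; layer `0` is the input. -/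
noncomputable def netLayer (σ : ℝ → ℝ) (w : Weights K n) (y : Fin n → ℝ) (k : Fin (K + 1)) :
    Fin n → ℝ :=
  Fin.induction (motive := fun _ => Fin n → ℝ) y (fun k x i => σ (∑ j, w k i j * x j)) k

theorem netLayer_succ (w : Weights K n) (y : Fin n → ℝ) (k : Fin K) :
    netLayer σ w y k.succ =
      fun i => σ ((Matrix.of (w k) *ᵥ netLayer σ w y k.castSucc) i) := rfl

theorem abs_netLayer_le_one (hσ : ∀ u, |σ u| ≤ 1) (w : Weights K n) {y : Fin n → ℝ}
    (hy : ∀ i, |y i| ≤ 1) (k : Fin (K + 1)) (i : Fin n) : |netLayer σ w y k i| ≤ 1 := by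
  induction k using Fin.cases with
  | zero => exact hy i
  | succ k => exact hσ _

/-- Makes the input of a layer constant while the weights of that layer move. -/
theorem netLayer_congr {w w' : Weights K n} (y : Fin n → ℝ) {k : Fin (K + 1)}
    (h : ∀ j : Fin K, j.castSucc < k → w j = w' j) : netLayer σ w y k = netLayer σ w' y k := by
  induction k using Fin.induction with
  | zero => rfl
  | succ k ih =>
    rw [netLayer_succ, netLayer_succ, h k Fin.castSucc_lt_succ,
      ih fun j hj => h j (hj.trans Fin.castSucc_lt_succ)]

theorem contDiff_netLayer (hσ : ContDiff ℝ 1 σ) (y : Fin n → ℝ) (k : Fin (K + 1)) :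
    ContDiff ℝ 1 fun w : Weights K n => netLayer σ w y k := by
  induction k using Fin.induction with
  | zero => exact contDiff_const
  | succ k ih =>
    simp only [netLayer_succ, Matrix.mulVec, dotProduct, Matrix.of_apply]
    refine contDiff_pi.2 fun i => hσ.comp (ContDiff.sum fun j _ => ContDiff.mul ?_ ?_)
    · exact (contDiff_apply_apply ℝ ℝ i j).comp (contDiff_apply ℝ (Fin n → Fin n → ℝ) k)
    · exact contDiff_pi.1 ih j

theorem contDiff_empError {m : ℕ} (hσ : ContDiff ℝ 1 σ) (y z : Fin m → Fin n → ℝ) :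
    ContDiff ℝ 1 (empError σ y z : Weights K n → ℝ) := by
  refine contDiff_const.mul (ContDiff.sum fun s _ => ContDiff.sum fun a _ => ContDiff.pow ?_ 2)
  -- `netOutput` is by definition `netLayer` at the last index.
  exact (contDiff_pi.1 (contDiff_netLayer hσ (y s) (Fin.last K)) a).sub contDiff_const

theorem empError_nonneg {m : ℕ} (y z : Fin m → Fin n → ℝ) (w : Weights K n) :
    0 ≤ empError σ y z w := by
  unfold empError
  positivity

end Network

/-! ### The layer polynomials -/

section Poly

variable {σ : ℝ → ℝ} {z : ℕ → ℝ}

theorem supAbs_nonneg (g : ℝ → ℝ) : 0 ≤ supAbs g := Real.iSup_nonneg fun _ => abs_nonneg _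

theorem abs_le_supAbs {g : ℝ → ℝ} (hg : BddAbove (Set.range fun u => |g u|)) (u : ℝ) :
    |g u| ≤ supAbs g := le_ciSup hg u

theorem polyR_nonneg (hz : ∀ j, 0 ≤ z j) (k : ℕ) : 0 ≤ polyR σ k z :=
  mul_nonneg (pow_nonneg (supAbs_nonneg _) k) (Finset.prod_nonneg fun j _ => hz j)

theorem polyR_succ (k : ℕ) : polyR σ (k + 1) z = supAbs (deriv σ) * z k * polyR σ k z := by
  simp only [polyR, Finset.prod_range_succ]
  ring

/-- Puts the recursion in the shape of the chain rule, `σ'' (P')² + σ' P''`, with `z k * polyR σ k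
z` in the role of `P'`. -/
theorem polyV_succ (k : ℕ) : polyV σ (k + 1) z =
    supAbs (deriv (deriv σ)) * (z k * polyR σ k z) ^ 2 + supAbs (deriv σ) * z k * polyV σ k z := by
  simp only [polyV, polyR, Finset.prod_pow]
  ring

theorem polyV_nonneg (hz : ∀ j, 0 ≤ z j) (k : ℕ) : 0 ≤ polyV σ k z := by
  induction k with
  | zero => exact le_rfl
  | succ k ih =>
    rw [polyV_succ]
    have h1 := supAbs_nonneg (deriv σ)
    have h2 := supAbs_nonneg (deriv (deriv σ))
    have h3 := hz k
    positivity

theorem constD1_nonneg (n : ℕ) (q : QNorm) : 0 ≤ constD1 n q := by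
  cases q <;> simp [constD1]

theorem constD2_nonneg (n : ℕ) (q : QNorm) : 0 ≤ constD2 n q := by
  cases q <;> simp [constD2]

theorem polyS_nonneg (n : ℕ) (q : QNorm) (hz : ∀ j, 0 ≤ z j) (k : ℕ) :
    0 ≤ polyS n q σ k z := by
  have h1 := supAbs_nonneg (deriv σ)
  have h2 := supAbs_nonneg (deriv (deriv σ))
  have h3 := constD1_nonneg n q
  have h4 := constD2_nonneg n q
  have h5 := polyR_nonneg (σ := σ) hz k
  have h6 := polyV_nonneg (σ := σ) hz k
  unfold polyS
  positivity

end Poly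

/-! ### Positivity of the layer factors -/

section LayerFactor

variable {K n : ℕ} {σ : ℝ → ℝ} (q : QNorm)

theorem upperNorms_nonneg (w : Weights K n) (i : Fin K) (j : ℕ) : 0 ≤ upperNorms q w i j := by
  unfold upperNorms
  split_ifs
  · exact matNorm_nonneg _ _
  · exact le_rfl

theorem layerP_sq (w : Weights K n) (i : Fin K) :
    layerP q σ w i ^ 2 = polyS n q σ (K - 1 - i.val) (upperNorms q w i) + 1 :=
  Real.sq_sqrt (add_nonneg (polyS_nonneg n q (upperNorms_nonneg q w i) _) zero_le_one)

theorem layerP_pos (w : Weights K n) (i : Fin K) : 0 < layerP q σ w i :=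
  Real.sqrt_pos.2
    (add_pos_of_nonneg_of_pos (polyS_nonneg n q (upperNorms_nonneg q w i) _) zero_lt_one)

end LayerFactor

/-! ### Derivatives along a change of a single layer -/

section Curve

variable {K n : ℕ} {σ : ℝ → ℝ} (q : QNorm)

theorem hasDerivAt_mulVec {X X₁ : ℝ → Fin n → ℝ} {t : ℝ} (A : Matrix (Fin n) (Fin n) ℝ)
    (h : ∀ a, HasDerivAt (fun t => X t a) (X₁ t a) t) (a : Fin n) :
    HasDerivAt (fun t => (A *ᵥ X t) a) ((A *ᵥ X₁ t) a) t := by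
  simp only [Matrix.mulVec, dotProduct]
  exact HasDerivAt.fun_sum fun b _ => (h b).const_mul (A a b)

/-- The first two derivatives of `σ ∘ P`, with bounds, for a curve `P` of preactivations. -/
theorem exists_derivs_activation (hσ : Differentiable ℝ σ) (hσ' : Differentiable ℝ (deriv σ))
    (hb₁ : BddAbove (Set.range fun u => |deriv σ u|))
    (hb₂ : BddAbove (Set.range fun u => |deriv (deriv σ) u|)) {P P₁ P₂ : ℝ → Fin n → ℝ}
    {B₁ B₂ : ℝ}
    (h₁ : ∀ t a, HasDerivAt (fun t => P t a) (P₁ t a) t)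
    (h₂ : ∀ t a, HasDerivAt (fun t => P₁ t a) (P₂ t a) t)
    (hB₁ : ∀ t, vecNorm q (P₁ t) ≤ B₁) (hB₂ : ∀ t, vecNorm q (P₂ t) ≤ B₂) :
    ∃ X₁ X₂ : ℝ → Fin n → ℝ, (∀ t a, HasDerivAt (fun t => σ (P t a)) (X₁ t a) t) ∧
      (∀ t a, HasDerivAt (fun t => X₁ t a) (X₂ t a) t) ∧
      (∀ t, vecNorm q (X₁ t) ≤ supAbs (deriv σ) * B₁) ∧
      ∀ t, vecNorm q (X₂ t) ≤ supAbs (deriv (deriv σ)) * B₁ ^ 2 + supAbs (deriv σ) * B₂ := by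
  refine ⟨fun t a => deriv σ (P t a) * P₁ t a,
    fun t => (fun a => deriv (deriv σ) (P t a) * P₁ t a ^ 2) + fun a => deriv σ (P t a) * P₂ t a,
    fun t a => (hσ _).hasDerivAt.comp t (h₁ t a), fun t a => ?_, fun t => ?_, fun t => ?_⟩
  · refine (((hσ' _).hasDerivAt.comp t (h₁ t a)).fun_mul (h₂ t a)).congr_deriv ?_
    simp only [Pi.add_apply, Function.comp_apply]
    ring
  · refine (vecNorm_mul_le q (fun a => abs_le_supAbs hb₁ _) _).trans ?_
    exact mul_le_mul_of_nonneg_left (hB₁ t) (supAbs_nonneg _)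
  · refine (vecNorm_add_le q _ _).trans (add_le_add ?_ ?_)
    · refine (vecNorm_mul_sq_le q (fun a => abs_le_supAbs hb₂ _) _).trans ?_
      exact mul_le_mul_of_nonneg_left (pow_le_pow_left₀ (vecNorm_nonneg q _) (hB₁ t) 2)
        (supAbs_nonneg _)
    · refine (vecNorm_mul_le q (fun a => abs_le_supAbs hb₁ _) _).trans ?_
      exact mul_le_mul_of_nonneg_left (hB₂ t) (supAbs_nonneg _)

/-- The first two derivatives, with bounds, of the output of the `k`-th layer above layer `i` when
the weights of layer `i` move along a line. -/
theorem exists_derivs_netLayer (hσ : Differentiable ℝ σ) (hσ' : Differentiable ℝ (deriv σ))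
    (hbd : ∀ u, |σ u| ≤ 1) (hb₁ : BddAbove (Set.range fun u => |deriv σ u|))
    (hb₂ : BddAbove (Set.range fun u => |deriv (deriv σ) u|)) (w : Weights K n)
    {y : Fin n → ℝ} (hy : ∀ i, |y i| ≤ 1) (i : Fin K) (D : Fin n → Fin n → ℝ) (k : ℕ)
    (hk : i.val + 1 + k < K + 1) :
    ∃ X₁ X₂ : ℝ → Fin n → ℝ,
      (∀ t a, HasDerivAt
        (fun t : ℝ => netLayer σ (w + t • (Pi.single i D : Weights K n)) y ⟨i.val + 1 + k, hk⟩ a)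
        (X₁ t a) t) ∧
      (∀ t a, HasDerivAt (fun t => X₁ t a) (X₂ t a) t) ∧
      (∀ t, vecNorm q (X₁ t) ≤ supAbs (deriv σ) * constC n q * matNorm q (Matrix.of D) *
        polyR σ k (upperNorms q w i)) ∧
      ∀ t, vecNorm q (X₂ t) ≤ (constC n q * matNorm q (Matrix.of D)) ^ 2 *
        (supAbs (deriv σ) ^ 2 * polyV σ k (upperNorms q w i) +
          supAbs (deriv (deriv σ)) * polyR σ k (upperNorms q w i)) := by
  induction k with
  | zero =>
    set x := netLayer σ w y i.castSucc with hx
    -- Layer `i` is the only place where the line enters: its input `x` is constant, so its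
    -- preactivation is affine in `t`, with velocity of norm at most `c_q ‖D‖` and no acceleration.
    have hcurve : ∀ t : ℝ, netLayer σ (w + t • (Pi.single i D : Weights K n)) y
        ⟨i.val + 1 + 0, hk⟩ =
        fun a => σ ((Matrix.of (w i) *ᵥ x) a + t * (Matrix.of D *ᵥ x) a) := by
      intro t
      have hlow : netLayer σ (w + t • (Pi.single i D : Weights K n)) y i.castSucc = x :=
        netLayer_congr y fun j hj => by
          have : j ≠ i := fun h => by simp [h] at hj
          simp [this]
      change netLayer σ (w + t • (Pi.single i D : Weights K n)) y i.succ = _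
      rw [netLayer_succ, hlow]
      ext a
      congr 1
      have : Matrix.of ((w + t • (Pi.single i D : Weights K n) : Weights K n) i) =
          Matrix.of (w i) + t • Matrix.of D := by
        ext a b
        simp
      rw [this, Matrix.add_mulVec, Matrix.smul_mulVec]
      rfl
    obtain ⟨X₁, X₂, h₁, h₂, hB₁, hB₂⟩ := exists_derivs_activation q hσ hσ' hb₁ hb₂
      (P := fun t a => (Matrix.of (w i) *ᵥ x) a + t * (Matrix.of D *ᵥ x) a)
      (P₁ := fun _ => Matrix.of D *ᵥ x) (P₂ := fun _ => 0)
      (B₁ := constC n q * matNorm q (Matrix.of D)) (B₂ := 0)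
      (fun t a => by
        simpa using ((hasDerivAt_id' t).mul_const ((Matrix.of D *ᵥ x) a)).const_add
          ((Matrix.of (w i) *ᵥ x) a))
      (fun t a => hasDerivAt_const t _)
      (fun t => by
        refine (vecNorm_mulVec_le q _ x).trans ?_
        rw [mul_comm]
        exact mul_le_mul_of_nonneg_right
          (vecNorm_le_constC q (abs_netLayer_le_one hbd w hy _)) (matNorm_nonneg _ _))
      (fun t => by
        have := vecNorm_smul q 0 (0 : Fin n → ℝ)
        simp only [zero_smul, abs_zero, zero_mul] at this
        exact this.le)
    refine ⟨X₁, X₂, fun t a => ?_, h₂, fun t => (hB₁ t).trans_eq ?_,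
      fun t => (hB₂ t).trans_eq ?_⟩
    · simpa only [hcurve] using h₁ t a
    · simp only [polyR, pow_zero, Finset.range_zero, Finset.prod_empty]
      ring
    · simp only [polyR, polyV, pow_zero, Finset.range_zero, Finset.prod_empty]
      ring
  | succ k ih =>
    have hk' : i.val + 1 + k < K := by omega
    obtain ⟨Y₁, Y₂, g₁, g₂, hY₁, hY₂⟩ := ih (by omega)
    set z := upperNorms q w i with hz
    set W := Matrix.of (w ⟨i.val + 1 + k, hk'⟩) with hW
    have hzk : z k = matNorm q W := by
      rw [hz, upperNorms, dif_pos hk']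
    have hcurve : ∀ t : ℝ, netLayer σ (w + t • (Pi.single i D : Weights K n)) y
        ⟨i.val + 1 + (k + 1), hk⟩ =
        fun a => σ ((W *ᵥ netLayer σ (w + t • (Pi.single i D : Weights K n)) y
          ⟨i.val + 1 + k, hk'.trans (Nat.lt_succ_self K)⟩) a) := by
      intro t
      have hne : (⟨i.val + 1 + k, hk'⟩ : Fin K) ≠ i := fun h => by
        have := congrArg Fin.val h
        simp only at this
        omega
      change netLayer σ (w + t • (Pi.single i D : Weights K n)) y
        (Fin.succ ⟨i.val + 1 + k, hk'⟩) = _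
      rw [netLayer_succ]
      have : Matrix.of ((w + t • (Pi.single i D : Weights K n) : Weights K n)
          ⟨i.val + 1 + k, hk'⟩) = W := by
        rw [Pi.add_apply, Pi.smul_apply, Pi.single_eq_of_ne hne, smul_zero, add_zero]
      rw [this]
      rfl
    -- The weights `W` of this layer are fixed, so the preactivation derivatives grow by at most the
    -- factor `‖W‖ = z k`; the activation bounds then reproduce the recursions for `r` and `v`.
    obtain ⟨X₁, X₂, h₁, h₂, hB₁, hB₂⟩ := exists_derivs_activation q hσ hσ' hb₁ hb₂
      (fun t => hasDerivAt_mulVec W (g₁ t)) (fun t => hasDerivAt_mulVec W (g₂ t))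
      (fun t => (vecNorm_mulVec_le q W _).trans
        (mul_le_mul_of_nonneg_left (hY₁ t) (matNorm_nonneg q W)))
      (fun t => (vecNorm_mulVec_le q W _).trans
        (mul_le_mul_of_nonneg_left (hY₂ t) (matNorm_nonneg q W)))
    refine ⟨X₁, X₂, fun t a => ?_, h₂, fun t => (hB₁ t).trans_eq ?_,
      fun t => (hB₂ t).trans_eq ?_⟩
    · simpa only [hcurve] using h₁ t a
    · rw [polyR_succ, hzk]
      ring
    · rw [polyR_succ, polyV_succ, hzk]
      ring

/-- Moving the weights of layer `i` changes the error by at most its linearization plus half of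
`p_i(w)²` times the squared norm of the change. -/
theorem empError_add_single_le {m : ℕ} (hm : 1 ≤ m) (hσ : Differentiable ℝ σ)
    (hσ' : Differentiable ℝ (deriv σ))
    (hbd : ∀ u, |σ u| ≤ 1) (hb₁ : BddAbove (Set.range fun u => |deriv σ u|))
    (hb₂ : BddAbove (Set.range fun u => |deriv (deriv σ) u|))
    {y z : Fin m → Fin n → ℝ} (hy : ∀ i j, |y i j| ≤ 1) (hz : ∀ i j, |z i j| ≤ 1)
    (w : Weights K n) (i : Fin K) (D : Fin n → Fin n → ℝ) :
    empError σ y z (w + Pi.single i D) ≤ empError σ y z w +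
      fderiv ℝ (empError σ y z) w (Pi.single i D) +
      layerP q σ w i ^ 2 * matNorm q (Matrix.of D) ^ 2 / 2 := by
  -- Output index of layer `i` plus the number of layers above it; truncated subtraction is harmless
  -- because `i < K`.
  have hlast : i.val + 1 + (K - 1 - i.val) < K + 1 := by omega
  have hidx : (⟨i.val + 1 + (K - 1 - i.val), hlast⟩ : Fin (K + 1)) = Fin.last K :=
    Fin.ext (by simp only [Fin.val_last]; omega)
  choose X₁ X₂ h₁ h₂ hB₁ hB₂ using fun s =>
    exists_derivs_netLayer q hσ hσ' hbd hb₁ hb₂ w (hy s) i D (K - 1 - i.val) hlast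
  simp only [hidx] at h₁
  set u : Weights K n := Pi.single i D with hu
  set ζ := upperNorms q w i with hζ
  set k := K - 1 - i.val
  set δ := matNorm q (Matrix.of D)
  have hm0 : (0 : ℝ) < m := by exact_mod_cast hm
  have hd₁ : ∀ t, HasDerivAt (fun t : ℝ => empError σ y z (w + t • u))
      (1 / (m : ℝ) * ∑ s, ∑ a, 2 * ((netLayer σ (w + t • u) (y s) (Fin.last K) a - z s a) *
        X₁ s t a)) t := by
    intro t
    refine HasDerivAt.const_mul _ (HasDerivAt.fun_sum fun s _ => HasDerivAt.fun_sum fun a _ => ?_)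
    refine (((h₁ s t a).sub_const (z s a)).fun_pow 2).congr_deriv ?_
    push_cast
    ring
  have hd₂ : ∀ t, HasDerivAt (fun t : ℝ => 1 / (m : ℝ) * ∑ s, ∑ a,
        2 * ((netLayer σ (w + t • u) (y s) (Fin.last K) a - z s a) * X₁ s t a))
      (1 / (m : ℝ) * ∑ s, ∑ a, 2 * (X₁ s t a * X₁ s t a +
        (netLayer σ (w + t • u) (y s) (Fin.last K) a - z s a) * X₂ s t a)) t := fun t =>
    HasDerivAt.const_mul _ (HasDerivAt.fun_sum fun s _ => HasDerivAt.fun_sum fun a _ =>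
      (((h₁ s t a).sub_const (z s a)).fun_mul (h₂ s t a)).const_mul 2)
  have hbound : ∀ t, 1 / (m : ℝ) * ∑ s, ∑ a, 2 * (X₁ s t a * X₁ s t a +
      (netLayer σ (w + t • u) (y s) (Fin.last K) a - z s a) * X₂ s t a) ≤
      -- This bound does not depend on `t`: `ζ` holds norms of layers above `i`, which the line
      -- leaves alone.
      polyS n q σ k ζ * δ ^ 2 := by
    intro t
    have hs : ∀ s, ∑ a, 2 * (X₁ s t a * X₁ s t a +
        (netLayer σ (w + t • u) (y s) (Fin.last K) a - z s a) * X₂ s t a) ≤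
        polyS n q σ k ζ * δ ^ 2 := by
      intro s
      have e1 := two_mul_sum_sq_le q (X₁ s t)
      have e2 := two_mul_sum_mul_le q
        (e := fun a => netLayer σ (w + t • u) (y s) (Fin.last K) a - z s a) (fun a => by
          have g1 := abs_le.1 (abs_netLayer_le_one hbd (w + t • u) (hy s) (Fin.last K) a)
          have g2 := abs_le.1 (hz s a)
          exact abs_le.2 ⟨by linarith [g1.1, g2.2], by linarith [g1.2, g2.1]⟩) (X₂ s t)
      have e3 := mul_le_mul_of_nonneg_left (pow_le_pow_left₀ (vecNorm_nonneg q _) (hB₁ s t) 2)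
        (constD2_nonneg n q)
      have e4 := mul_le_mul_of_nonneg_left (hB₂ s t) (constD1_nonneg n q)
      calc _ = 2 * ∑ a, X₁ s t a ^ 2 +
            2 * ∑ a, (netLayer σ (w + t • u) (y s) (Fin.last K) a - z s a) * X₂ s t a := by
            simp only [Finset.mul_sum, ← Finset.sum_add_distrib]
            exact Finset.sum_congr rfl fun a _ => by ring
        _ ≤ _ := add_le_add (e1.trans e3) (e2.trans e4)
        _ = _ := by
            simp only [polyS]
            ring
    calc _ ≤ 1 / (m : ℝ) * ∑ _s : Fin m, polyS n q σ k ζ * δ ^ 2 :=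
          mul_le_mul_of_nonneg_left (Finset.sum_le_sum fun s _ => hs s) (by positivity)
      _ = _ := by
          simp only [Finset.sum_const, Finset.card_univ, Fintype.card_fin, nsmul_eq_mul]
          field_simp
  have htaylor := le_taylor_of_second_deriv_le hd₁ hd₂ hbound
  have hσ1 : ContDiff ℝ 1 σ := contDiff_one_iff_deriv.2 ⟨hσ, hσ'.continuous⟩
  have hline :=
    ((contDiff_empError hσ1 y z).differentiable one_ne_zero w).hasFDerivAt.hasLineDerivAt u
  -- The explicit derivative at `t = 0` is identified with `fderiv` by uniqueness. The spare `+1` in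
  -- `p_i²` is then absorbed through `δ² ≥ 0`.
  rw [HasDerivAt.unique (hd₁ 0) hline] at htaylor
  simp only [one_smul, zero_smul, add_zero] at htaylor
  rw [layerP_sq]
  have := sq_nonneg δ
  linarith

end Curve

/-! ### The Finsler structure and the duality structure of the network -/

section Structure

variable {K n : ℕ} {σ : ℝ → ℝ} (q : QNorm)

theorem continuous_polyR (k : ℕ) : Continuous (polyR σ k) :=
  continuous_const.mul (continuous_finsetProd _ fun j _ => continuous_apply j)

theorem continuous_polyV (k : ℕ) : Continuous (polyV σ k) := by
  induction k with
  | zero => exact continuous_const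
  | succ k ih =>
    simp only [funext fun z => polyV_succ (σ := σ) (z := z) k]
    have := continuous_polyR (σ := σ) k
    fun_prop

theorem continuous_polyS (k : ℕ) : Continuous (polyS n q σ k) := by
  have h1 := continuous_polyR (σ := σ) k
  have h2 := continuous_polyV (σ := σ) k
  unfold polyS
  fun_prop

theorem continuous_matNorm_of {X : Type*} [TopologicalSpace X] {g : X → Fin n → Fin n → ℝ}
    (hg : Continuous g) : Continuous fun x => matNorm q (Matrix.of (g x)) :=
  (continuous_matNorm q).comp hg

theorem continuous_layerP (i : Fin K) : Continuous fun w : Weights K n => layerP q σ w i := by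
  have h : Continuous fun w : Weights K n => upperNorms q w i := by
    refine continuous_pi fun j => ?_
    by_cases hj : i.val + 1 + j < K
    · simp only [upperNorms, dif_pos hj]
      exact continuous_matNorm_of q (continuous_apply _)
    · simp only [upperNorms, dif_neg hj]
      exact continuous_const
  exact Real.continuous_sqrt.comp (((continuous_polyS q _).comp h).add continuous_const)

theorem netNorm_term_nonneg (w u : Weights K n) (i : Fin K) :
    0 ≤ layerP q σ w i * matNorm q (Matrix.of (u i)) :=
  mul_nonneg (layerP_pos q w i).le (matNorm_nonneg q _)

theorem isFinslerStructure_netNorm :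
    IsFinslerStructure (netNorm q σ : Weights K n → Weights K n → ℝ) where
  nonneg w u := Finset.sum_nonneg fun i _ => netNorm_term_nonneg q w u i
  eq_zero_iff w u := by
    rw [netNorm, Finset.sum_eq_zero_iff_of_nonneg fun i _ => netNorm_term_nonneg q w u i]
    simp only [Finset.mem_univ, true_imp_iff, mul_eq_zero, (layerP_pos q w _).ne', false_or,
      matNorm_eq_zero_iff]
    exact ⟨fun h => funext h, fun h i => congrFun h i⟩
  smul w c u := by
    simp only [netNorm, Finset.mul_sum]
    refine Finset.sum_congr rfl fun i _ => ?_
    have : Matrix.of ((c • u) i) = c • Matrix.of (u i) := rfl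
    rw [this, matNorm_smul]
    ring
  add_le w u v := by
    simp only [netNorm, ← Finset.sum_add_distrib, ← mul_add]
    refine Finset.sum_le_sum fun i _ => mul_le_mul_of_nonneg_left ?_ (layerP_pos q w i).le
    exact matNorm_add_le q (Matrix.of (u i)) (Matrix.of (v i))
  continuous := continuous_finsetSum _ fun i _ =>
    ((continuous_layerP q i).comp continuous_fst).mul
      (continuous_matNorm_of q ((continuous_apply i).comp continuous_snd))

theorem clm_apply_eq_sum (l : Weights K n →L[ℝ] ℝ) (u : Weights K n) :
    l u = ∑ i, ∑ a, ∑ b, layerComp l i a b * u i a b := by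
  have hu : u = ∑ i, ∑ a, ∑ b,
      u i a b • (Pi.single i (Pi.single a (Pi.single b 1)) : Weights K n) := by
    ext i a b
    simp only [Finset.sum_apply, Pi.smul_apply, smul_eq_mul]
    rw [Finset.sum_eq_single i (fun j _ hj => by simp [Pi.single_eq_of_ne hj.symm]) (by simp),
      Finset.sum_eq_single a (fun j _ hj => by simp [Pi.single_eq_of_ne hj.symm]) (by simp),
      Finset.sum_eq_single b (fun j _ hj => by simp [Pi.single_eq_of_ne hj.symm]) (by simp)]
    simp
  conv_lhs => rw [hu]
  simp only [map_sum, map_smul, smul_eq_mul, layerComp, Matrix.of_apply, mul_comm]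

theorem clm_apply_single (l : Weights K n →L[ℝ] ℝ) (i : Fin K) (D : Fin n → Fin n → ℝ) :
    l (Pi.single i D) = ∑ a, ∑ b, layerComp l i a b * D a b := by
  rw [clm_apply_eq_sum, Finset.sum_eq_single i (fun j _ hj => by simp [Pi.single_eq_of_ne hj])
    (by simp)]
  simp

/-- The closed form `max_i ‖l_i‖_q / p_i(w)` of the dual norm. -/
noncomputable def netDual (q : QNorm) (σ : ℝ → ℝ) (layerRule : (Fin K → ℝ) → Fin K)
    (w : Weights K n) (l : Weights K n →L[ℝ] ℝ) : ℝ :=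
  1 / layerP q σ w (bestLayer q σ layerRule w l) *
    matDualNorm q (layerComp l (bestLayer q σ layerRule w l))

theorem netDual_nonneg (layerRule : (Fin K → ℝ) → Fin K) (w : Weights K n)
    (l : Weights K n →L[ℝ] ℝ) : 0 ≤ netDual q σ layerRule w l :=
  mul_nonneg (one_div_nonneg.2 (layerP_pos q w _).le) (matDualNorm_nonneg q _)

/-- The dual of a weighted sum norm is a weighted maximum: each layer's pairing is bounded
separately and the argmax dominates every ratio. -/
theorem apply_le_netDual_mul {layerRule : (Fin K → ℝ) → Fin K} (hlayer : IsArgmaxRule layerRule)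
    (w : Weights K n) (l : Weights K n →L[ℝ] ℝ) (u : Weights K n) :
    l u ≤ netDual q σ layerRule w l * netNorm q σ w u := by
  rw [clm_apply_eq_sum, netNorm, Finset.mul_sum]
  refine Finset.sum_le_sum fun i _ => (sum_mul_le q _ (Matrix.of (u i))).trans ?_
  have h : 1 / layerP q σ w i * matDualNorm q (layerComp l i) ≤ netDual q σ layerRule w l :=
    hlayer (fun i => 1 / layerP q σ w i * matDualNorm q (layerComp l i)) i
  rw [one_div_mul_eq_div, div_le_iff₀ (layerP_pos q w i)] at h
  rw [← mul_assoc]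
  exact mul_le_mul_of_nonneg_right h (matNorm_nonneg q _)

theorem netNorm_netDuality (layerRule : (Fin K → ℝ) → Fin K)
    {rowRule : (Fin n → ℝ) → Fin n} (hrow : IsArgmaxRule rowRule) (w : Weights K n)
    (l : Weights K n →L[ℝ] ℝ) :
    netNorm q σ w (netDuality q σ layerRule rowRule w l) = netDual q σ layerRule w l := by
  have h0 : matNorm q (Matrix.of (0 : Fin n → Fin n → ℝ)) = 0 :=
    (matNorm_eq_zero_iff q _).2 rfl
  unfold netDuality netDual
  set i := bestLayer q σ layerRule w l
  rw [netNorm, Finset.sum_eq_single i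
    (fun j _ hj => by rw [Pi.single_eq_of_ne hj, h0, mul_zero]) (by simp), Pi.single_eq_same]
  have h1 : (Matrix.of fun a b => 1 / layerP q σ w i ^ 2 *
      matDuality rowRule q (layerComp l i) a b) =
      (1 / layerP q σ w i ^ 2) • matDuality rowRule q (layerComp l i) := rfl
  have hp := layerP_pos (σ := σ) q w i
  rw [h1, matNorm_smul, matNorm_matDuality hrow, abs_of_nonneg (by positivity)]
  field_simp

theorem apply_netDuality (layerRule : (Fin K → ℝ) → Fin K)
    {rowRule : (Fin n → ℝ) → Fin n} (hrow : IsArgmaxRule rowRule) (w : Weights K n)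
    (l : Weights K n →L[ℝ] ℝ) :
    l (netDuality q σ layerRule rowRule w l) = netDual q σ layerRule w l ^ 2 := by
  unfold netDuality netDual
  set i := bestLayer q σ layerRule w l
  have h1 := sum_mul_matDuality hrow q (layerComp l i)
  rw [clm_apply_single, mul_pow, ← h1]
  simp only [Finset.mul_sum]
  exact Finset.sum_congr rfl fun a _ => Finset.sum_congr rfl fun b _ => by ring

theorem dualNorm_netNorm_eq (hK : 1 ≤ K) (hn : 1 ≤ n) {layerRule : (Fin K → ℝ) → Fin K}
    (hlayer : IsArgmaxRule layerRule) {rowRule : (Fin n → ℝ) → Fin n}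
    (hrow : IsArgmaxRule rowRule) (w : Weights K n) (l : Weights K n →L[ℝ] ℝ) :
    dualNorm (netNorm q σ) w l = netDual q σ layerRule w l := by
  have : Nonempty (Fin K) := ⟨⟨0, hK⟩⟩
  have : Nonempty (Fin n) := ⟨⟨0, hn⟩⟩
  exact dualNorm_eq_of_attained (isFinslerStructure_netNorm q) (netDual_nonneg q layerRule w l)
    (apply_le_netDual_mul q hlayer w l) (netNorm_netDuality q layerRule hrow w l)
    (apply_netDuality q layerRule hrow w l)

/-- The copied layers are those where the duality map, supported on one layer, vanishes. -/
theorem isDSGD_of_isBatchRun {m : ℕ} {y z : Fin m → Fin n → ℝ}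
    {layerRule : (Fin K → ℝ) → Fin K} {rowRule : (Fin n → ℝ) → Fin n} {ε : ℝ}
    {w : ℕ → Weights K n} (hw : IsBatchRun q σ y z layerRule rowRule ε w) :
    IsDSGD (empError σ y z) (netDuality q σ layerRule rowRule) (fun _ => ε) w := by
  intro t ht
  obtain ⟨h1, h2⟩ := hw t ht
  set g := fderiv ℝ (empError σ y z) (w t)
  change ∀ a b, w (t + 1) (bestLayer q σ layerRule (w t) g) a b = _ at h1
  change ∀ i, i ≠ bestLayer q σ layerRule (w t) g → _ at h2
  ext i a b
  by_cases hi : i = bestLayer q σ layerRule (w t) g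
  · subst hi
    rw [h1]
    simp only [Pi.sub_apply, Pi.smul_apply, smul_eq_mul, netDuality, Pi.single_eq_same]
    rw [← mul_assoc]
    rfl
  · rw [h2 i hi]
    simp [netDuality, Pi.single_eq_of_ne hi]

end Structure

end NetDSGD

/-! ### Sufficient decrease of the training run and conclusion -/

theorem mainTheorem3 (K n m : ℕ) (hK : 1 ≤ K) (hn : 1 ≤ n) (hm : 1 ≤ m) (q : QNorm)
    (σ : ℝ → ℝ)
    (hσ_diff : Differentiable ℝ σ) (hσ_diff2 : Differentiable ℝ (deriv σ))
    (hσ_bdd : ∀ u, |σ u| ≤ 1)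
    (hσ_bdd1 : BddAbove (Set.range fun u => |deriv σ u|))
    (hσ_bdd2 : BddAbove (Set.range fun u => |deriv (deriv σ) u|))
    (y z : Fin m → Fin n → ℝ) (hy : ∀ i j, |y i j| ≤ 1) (hz : ∀ i j, |z i j| ≤ 1)
    (layerRule : (Fin K → ℝ) → Fin K) (hlayer : IsArgmaxRule layerRule)
    (rowRule : (Fin n → ℝ) → Fin n) (hrow : IsArgmaxRule rowRule)
    (ε : ℝ) (hε : ε ∈ Set.Ioo (0 : ℝ) 2)
    (w : ℕ → Weights K n) (hw : IsBatchRun q σ y z layerRule rowRule ε w) :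
    ContDiff ℝ 1 (empError σ y z : Weights K n → ℝ) ∧
    IsFinslerStructure (netNorm q σ : Weights K n → Weights K n → ℝ) ∧
    IsDualityStructure (netNorm q σ) (netDuality q σ layerRule rowRule) ∧
    IsDSGD (empError σ y z) (netDuality q σ layerRule rowRule) (fun _ => ε) w ∧
    (FiniteTermination (empError σ y z) w ∨
      AsymptoticConvergence (netNorm q σ) (empError σ y z) w) ∧
    ∀ δ : ℝ, 0 < δ → ∀ T : ℕ, 1 ≤ T →
      1 / δ ^ 2 * (2 / (ε * (2 - ε))) * empError σ y z (w 1) ≤ (T : ℝ) →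
      ∃ t, 1 ≤ t ∧ t ≤ T ∧
        dualNorm (netNorm q σ) (w t) (fderiv ℝ (empError σ y z) (w t)) ≤ δ := by
  have hσ1 : ContDiff ℝ 1 σ := contDiff_one_iff_deriv.2 ⟨hσ_diff, hσ_diff2.continuous⟩
  have hf := contDiff_empError (K := K) hσ1 y z
  have hN := isFinslerStructure_netNorm (K := K) (n := n) (σ := σ) q
  have hdual := fun w l => dualNorm_netNorm_eq (σ := σ) q hK hn hlayer hrow w l
  have hrun := isDSGD_of_isBatchRun q hw
  refine ⟨hf, hN, fun w l => ?_, hrun, convergence_of_sufficient_decrease hN hf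
    (empError_nonneg y z) (fun w l u => ?_) (fun w l => ?_) hε fun t ht => ?_⟩
  · rw [hdual]
    exact ⟨netNorm_netDuality q layerRule hrow w l, apply_netDuality q layerRule hrow w l⟩
  · rw [hdual]
    exact apply_le_netDual_mul q hlayer w l u
  · rw [hdual]
    exact netDual_nonneg q layerRule w l
  · set g := fderiv ℝ (empError σ y z) (w t) with hg
    set i := bestLayer q σ layerRule (w t) g with hi
    set ρ := matDuality rowRule q (layerComp g i) with hρ
    set c := 1 / layerP q σ (w t) i ^ 2 with hc
    have hp := layerP_pos (σ := σ) q (w t) i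
    have hρw : netDuality q σ layerRule rowRule (w t) g = Pi.single i fun a b => c * ρ a b := rfl
    have hnext : w (t + 1) = w t + Pi.single i ((-ε) • fun a b => c * ρ a b) := by
      rw [hrun t ht, ← hg, hρw, Pi.single_smul, neg_smul, sub_eq_add_neg]
    have hdesc := empError_add_single_le q hm hσ_diff hσ_diff2 hσ_bdd hσ_bdd1 hσ_bdd2 hy hz (w t) i
      ((-ε) • fun a b => c * ρ a b)
    have hlin : g (Pi.single i ((-ε) • fun a b => c * ρ a b)) =
        -ε * netDual q σ layerRule (w t) g ^ 2 := by
      rw [Pi.single_smul, map_smul, ← hρw, apply_netDuality q layerRule hrow, smul_eq_mul]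
    -- With `D` the dual norm, the linear term is `-ε D²` and the quadratic one `ε² D² / 2`; they
    -- add up to `-ε(2-ε)/2 · D²`.
    have hsize : layerP q σ (w t) i ^ 2 *
        matNorm q (Matrix.of ((-ε) • fun a b => c * ρ a b)) ^ 2 =
        ε ^ 2 * netDual q σ layerRule (w t) g ^ 2 := by
      have h1 : Matrix.of ((-ε) • fun a b => c * ρ a b) = (-ε * c) • ρ := by
        ext a b
        simp [mul_assoc]
      rw [h1, matNorm_smul, hρ, matNorm_matDuality hrow, mul_pow, sq_abs, netDual, ← hi, hc]
      field_simp
    rw [hdual, hnext]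
    rw [← hg, hlin, hsize] at hdesc
    linarith
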